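/- Let $\mathcal N=(P,E,pre,post,s_0)$ be an elementary Petri net, with places $P$, events $E$, maps $pre,post:E\to 2^P$ and initial state $s_0\subseteq P$. For $a\in E$ and $s\subseteq P$ the state $s\cdot a=(s\setminus pre(a))\cup post(a)$ is defined if and only if $pre(a)\subseteq s$ and $(s\setminus pre(a))\cap post(a)=\emptyset$. Let $M(E,I)$ be the trace monoid generated by $E$ with relations $ab=ba$ for $(a,b)\in I$, where $(a,b)\in I$ iff $(pre(a)\cup post(a))\cap(pre(b)\cup post(b))=\emptyset$. It acts partially from the right on the set $S=\{0,1\}^P$ of all subsets of $P$; the pair $(S,M(E,I))$ is the state space of $\mathcal N$, and restricting the action to the set of states $s_0\cdot\mu$ ($\mu\in M(E,I)$) gives the space of reachable states. The state category $K(S)$ of a state space $(S,M(E,I))$ has the elements of $S$ as objects; the morphisms $s\to t$ are the $\mu\in M(E,I)$ with $s\cdot\mu=t$, composed by multiplication of traces. Let $\Delta^0\mathbb Z:K(S)\to \mathrm{Ab}$ and $\Delta^1\mathbb Z:K(S)^{op}\to \mathrm{Ab}$ be the functors that are constantly $\mathbb Z$ on objects and send the morphism given by $\mu$ to the identity if $\mu=1$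 and to $0$ if $\mu\neq 1$. The directed homology groups of the state space are $$H_k^0(S,M(E,I))=\mathrm{colim}_k^{K(S)}\Delta^0\mathbb Z,\qquad H_k^1(S,M(E,I))=\mathrm{colim}_k^{K(S)^{op}}\Delta^1\mathbb Z ,$$ where $\mathrm{colim}_k^{\mathcal C}$ is the $k$-th left derived functor of $\mathrm{colim}^{\mathcal C}:\mathrm{Ab}^{\mathcal C}\to\mathrm{Ab}$. The directed homology groups $H_k^\varepsilon(\mathcal N)$ of a net are those of its state space. For $n\ge 2$ let $\mathfrak P_n$ be the pipeline net $t_1\to p_1\to t_2\to p_2\to\cdots\to p_{n-1}\to t_n$, that is, $P=\{p_1,\dots,p_{n-1}\}$, $E=\{t_1,\dots,t_n\}$, $pre(t_1)=\emptyset$, $pre(t_i)=\{p_{i-1}\}$ for $i\ge 2$, $post(t_i)=\{p_i\}$ for $i\le n-1$, $post(t_n)=\emptyset$, with an arbitrary initial state $s_0\subseteq P$. **Theorem.** For all $n\ge 2$, $k\ge 0$ and $\varepsilon\in\{0,1\}$, $$H_k^\varepsilon(\mathfrak P_n)=0 .$$ The directed homology groups of the space of reachable states of $\mathfrak P_n$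 vanish as well, for every initial state $s_0$. -/

import Mathlib

open CategoryTheory CategoryTheory.Limits

/-! ### Derived functors of the colimit -/

/-- The category `Ab^J` has enough projectives. -/
instance enoughProjectives_functor_ab (J : Type) [SmallCategory J] :
    EnoughProjectives (J ⥤ AddCommGrpCat.{0}) := by
  have hAb : EnoughProjectives AddCommGrpCat.{0} :=
    (Equivalence.enoughProjectives_iff
      (forget₂ (ModuleCat.{0} ℤ) AddCommGrpCat.{0}).asEquivalence).1 inferInstance
  refine ⟨fun F => ?_⟩
  let L : J → (J ⥤ AddCommGrpCat.{0}) := fun j =>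
    (evaluationLeftAdjoint AddCommGrpCat.{0} j).obj (Projective.over (F.obj j))
  have hL : ∀ j, Projective (L j) := fun j =>
    (evaluationAdjunctionRight AddCommGrpCat.{0} j).map_projective _ inferInstance
  let φ : ∀ j, L j ⟶ F := fun j =>
    ((evaluationAdjunctionRight AddCommGrpCat.{0} j).homEquiv _ _).symm (Projective.π (F.obj j))
  let q : (∐ L) ⟶ F := Sigma.desc φ
  have hq : Epi q := by
    rw [NatTrans.epi_iff_epi_app]
    intro j
    have key : (evaluationAdjunctionRight AddCommGrpCat.{0} j).homEquiv _ _ (Sigma.ι L j ≫ q) =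
        Projective.π (F.obj j) := by
      rw [Sigma.ι_desc, Equiv.apply_symm_apply]
    rw [Adjunction.homEquiv_unit, Functor.map_comp, ← Category.assoc] at key
    have hE : Epi (Projective.π (F.obj j)) := inferInstance
    rw [← key] at hE
    exact @epi_of_epi _ _ _ _ _ _ _ hE
  have hP : Projective (∐ L) := inferInstance
  exact ⟨{ p := ∐ L, projective := hP, f := q, epi := hq }⟩

/-- The functor `colim : Ab^J ⥤ Ab` is additive. -/
instance colim_ab_additive (J : Type) [SmallCategory J] :
    (colim : (J ⥤ AddCommGrpCat.{0}) ⥤ AddCommGrpCat.{0}).Additive := by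
  have : (Functor.const J : AddCommGrpCat.{0} ⥤ _).Additive := ⟨by intros; rfl⟩
  exact colimConstAdj.left_adjoint_additive

/-- The homology group `colim_k^J F` of the small category `J` with coefficients in `F`: the value
at `F` of the `k`-th left derived functor of `colim : Ab^J ⥤ Ab`. -/
noncomputable def colimDerived {J : Type} [SmallCategory J] (F : J ⥤ AddCommGrpCat.{0}) (k : ℕ) :
    AddCommGrpCat.{0} :=
  ((colim : (J ⥤ AddCommGrpCat.{0}) ⥤ AddCommGrpCat.{0}).leftDerived k).obj F

/-! ### Partial actions and trace monoids -/

/-- The monoid of partial maps `S ⇀ S`, with the product `f * g` given by "first `f`, then `g`". -/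
def PartialEnd (S : Type) : Type := S →. S

namespace PartialEnd

instance (S : Type) : Monoid (PartialEnd S) where
  one := PFun.id S
  mul f g := PFun.comp g f
  mul_assoc f g h := (PFun.comp_assoc h g f).symm
  one_mul f := PFun.comp_id f
  mul_one f := PFun.id_comp f

/-- The (possibly undefined) value of `f` at `s`. -/
def app {S : Type} (f : PartialEnd S) (s : S) : Part S := (f : S →. S) s

theorem ext {S : Type} {f g : PartialEnd S} (h : ∀ s t, t ∈ f.app s ↔ t ∈ g.app s) : f = g :=
  PFun.ext h

theorem mem_one {S : Type} {s t : S} : t ∈ (1 : PartialEnd S).app s ↔ t = s :=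
  Part.mem_some_iff

theorem mem_mul {S : Type} {f g : PartialEnd S} {s u : S} :
    u ∈ (f * g).app s ↔ ∃ t, t ∈ f.app s ∧ u ∈ g.app t :=
  Part.mem_bind_iff

/-- The restriction of a partial map to a subset `T` of `S`: the value at `s` is the value of `f`
at `s` if that is defined and lies in `T`. -/
def restrict {S : Type} (f : PartialEnd S) (T : Set S) : PartialEnd T := fun s =>
  (f.app s.1).bind fun t => ⟨t ∈ T, fun h => ⟨t, h⟩⟩

theorem mem_restrict {S : Type} {f : PartialEnd S} {T : Set S} {s t : T} :
    t ∈ (f.restrict T).app s ↔ t.1 ∈ f.app s.1 := by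
  refine Part.mem_bind_iff.trans ⟨?_, fun h => ⟨t.1, h, t.2, rfl⟩⟩
  rintro ⟨_, h, _, rfl⟩
  exact h

end PartialEnd

/-- The relations `ab = ba` for all `(a, b) ∈ I`. -/
inductive TraceRel {E : Type} (I : E → E → Prop) : FreeMonoid E → FreeMonoid E → Prop
  | comm (a b : E) (h : I a b) :
      TraceRel I (FreeMonoid.of a * FreeMonoid.of b) (FreeMonoid.of b * FreeMonoid.of a)

/-- The trace monoid `M(E, I)`: generators `E`, relations `ab = ba` for `(a, b) ∈ I`. -/
abbrev TraceMonoid {E : Type} (I : E → E → Prop) : Type := PresentedMonoid (TraceRel I)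

/-- The length of a trace. -/
def TraceMonoid.length {E : Type} {I : E → E → Prop} : TraceMonoid I →* Multiplicative ℕ :=
  PresentedMonoid.lift (fun _ => Multiplicative.ofAdd 1) (by
    rintro _ _ ⟨a, b, -⟩
    simp)

theorem TraceMonoid.eq_one_of_length {E : Type} {I : E → E → Prop} {μ : TraceMonoid I}
    (h : TraceMonoid.length μ = 1) : μ = 1 := by
  obtain ⟨w, rfl⟩ := PresentedMonoid.surjective_mk μ
  induction w with
  | one => exact map_one _
  | of x => exact absurd (congrArg Multiplicative.toAdd h) Nat.one_ne_zero
  | mul x y hx hy =>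
    rw [map_mul, map_mul] at h
    have h' := congrArg Multiplicative.toAdd h
    rw [toAdd_mul, toAdd_one, Nat.add_eq_zero_iff] at h'
    rw [map_mul, hx (Multiplicative.toAdd.injective h'.1),
      hy (Multiplicative.toAdd.injective h'.2), one_mul]

theorem TraceMonoid.mul_eq_one_iff {E : Type} {I : E → E → Prop} {μ ν : TraceMonoid I} :
    μ * ν = 1 ↔ μ = 1 ∧ ν = 1 := by
  refine ⟨fun h => ?_, fun h => by rw [h.1, h.2, one_mul]⟩
  have h' := congrArg (fun x => Multiplicative.toAdd (TraceMonoid.length x)) h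
  simp only [map_mul, map_one, toAdd_mul, toAdd_one, Nat.add_eq_zero_iff] at h'
  exact ⟨TraceMonoid.eq_one_of_length (Multiplicative.toAdd.injective h'.1),
    TraceMonoid.eq_one_of_length (Multiplicative.toAdd.injective h'.2)⟩

/-- A state space `(S, M(E, I))`: a set `S` with a partial right action of a trace monoid.
`t ∈ (act μ).app s` means that `s · μ` is defined and equal to `t`. -/
structure StateSpace where
  /-- The set of states. -/
  State : Type
  /-- The set of events. -/
  Event : Type
  /-- The independence relation. -/
  indep : Event → Event → Prop
  /-- The partial right action. -/
  act : TraceMonoid indep →* PartialEnd State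

namespace StateSpace

/-- The state category `K(S)`: its objects are the states. -/
structure StateCategory (X : StateSpace) : Type where
  /-- The underlying state. -/
  state : X.State

/-- A morphism `s ⟶ t` of the state category is a trace `μ` such that `s · μ = t`; the composite of
`μ : s ⟶ t` and `ν : t ⟶ u` is `μ * ν : s ⟶ u`. -/
instance (X : StateSpace) : SmallCategory X.StateCategory where
  Hom s t := {μ : TraceMonoid X.indep // t.state ∈ (X.act μ).app s.state}
  id s := ⟨1, by rw [map_one, PartialEnd.mem_one]⟩
  comp f g := ⟨f.1 * g.1, by rw [map_mul, PartialEnd.mem_mul]; exact ⟨_, f.2, g.2⟩⟩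
  id_comp f := Subtype.ext (one_mul _)
  comp_id f := Subtype.ext (mul_one _)
  assoc f g h := Subtype.ext (mul_assoc _ _ _)

/-- The trace `μ` of a morphism `s ⟶ t` of the state category. -/
def trace {X : StateSpace} {s t : X.StateCategory} (f : s ⟶ t) : TraceMonoid X.indep := f.1

theorem trace_id {X : StateSpace} (s : X.StateCategory) : trace (𝟙 s) = 1 := rfl

theorem trace_comp {X : StateSpace} {s t u : X.StateCategory} (f : s ⟶ t) (g : t ⟶ u) :
    trace (f ≫ g) = trace f * trace g := rfl

open Classical in
/-- The functor `Δ⁰ℤ : K(S) ⥤ Ab`: it is `ℤ` on objects, and sends a morphism with trace `μ` to the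
identity if `μ = 1` and to zero otherwise. -/
noncomputable def delta0 (X : StateSpace) : X.StateCategory ⥤ AddCommGrpCat.{0} where
  obj _ := AddCommGrpCat.of ℤ
  map f := if trace f = 1 then 𝟙 _ else 0
  map_id s := if_pos (trace_id s)
  map_comp f g := by
    rw [trace_comp, TraceMonoid.mul_eq_one_iff]
    by_cases hf : trace f = 1 <;> by_cases hg : trace g = 1 <;> simp [hf, hg]

open Classical in
/-- The functor `Δ¹ℤ : K(S)ᵒᵖ ⥤ Ab`: it is `ℤ` on objects, and sends a morphism with trace `μ` to
the identity if `μ = 1` and to zero otherwise. -/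
noncomputable def delta1 (X : StateSpace) : X.StateCategoryᵒᵖ ⥤ AddCommGrpCat.{0} where
  obj _ := AddCommGrpCat.of ℤ
  map f := if trace f.unop = 1 then 𝟙 _ else 0
  map_id s := if_pos (trace_id s.unop)
  map_comp f g := by
    rw [unop_comp, trace_comp, TraceMonoid.mul_eq_one_iff]
    by_cases hf : trace f.unop = 1 <;> by_cases hg : trace g.unop = 1 <;> simp [hf, hg]

/-- The directed homology groups `H_k^ε(S, M(E, I))` of a state space, `ε ∈ {0, 1}`. -/
noncomputable def directedHomology (X : StateSpace) : Fin 2 → ℕ → AddCommGrpCat.{0}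
  | 0, k => colimDerived X.delta0 k
  | 1, k => colimDerived X.delta1 k

/-- The set of states reachable from `s₀`. -/
def reachable (X : StateSpace) (s₀ : X.State) : Set X.State :=
  {t | ∃ μ, t ∈ (X.act μ).app s₀}

/-- The space of states reachable from `s₀`, with the restricted partial action. -/
def reachableSpace (X : StateSpace) (s₀ : X.State) : StateSpace where
  State := X.reachable s₀
  Event := X.Event
  indep := X.indep
  act :=
    { toFun := fun μ => (X.act μ).restrict (X.reachable s₀)
      map_one' := PartialEnd.ext fun s t => by
        rw [PartialEnd.mem_restrict, map_one, PartialEnd.mem_one, PartialEnd.mem_one,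
          Subtype.ext_iff]
      map_mul' := fun μ ν => PartialEnd.ext fun s u => by
        rw [PartialEnd.mem_restrict, map_mul, PartialEnd.mem_mul, PartialEnd.mem_mul]
        constructor
        · rintro ⟨t, h1, h2⟩
          obtain ⟨κ, hκ⟩ := s.2
          refine ⟨⟨t, κ * μ, ?_⟩, PartialEnd.mem_restrict.2 h1, PartialEnd.mem_restrict.2 h2⟩
          rw [map_mul, PartialEnd.mem_mul]
          exact ⟨_, hκ, h1⟩
        · rintro ⟨t, h1, h2⟩
          exact ⟨t.1, PartialEnd.mem_restrict.1 h1, PartialEnd.mem_restrict.1 h2⟩ }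

end StateSpace

/-! ### Elementary Petri nets -/

/-- An elementary Petri net with places `P`, events `E` and initial state `init ⊆ P`. -/
structure ElementaryPetriNet (P E : Type) where
  /-- The set of input places of an event. -/
  pre : E → Set P
  /-- The set of output places of an event. -/
  post : E → Set P
  /-- The initial state. -/
  init : Set P

namespace ElementaryPetriNet

variable {P E : Type} (N : ElementaryPetriNet P E)

/-- Two events are independent if their neighbourhoods are disjoint. -/
def Indep (a b : E) : Prop := (N.pre a ∪ N.post a) ∩ (N.pre b ∪ N.post b) = ∅

/-- The partial map `s ↦ s · a = (s \ pre a) ∪ post a`, defined when `pre a ⊆ s` and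
`(s \ pre a) ∩ post a = ∅`. -/
def step (a : E) : PartialEnd (Set P) := fun s =>
  ⟨N.pre a ⊆ s ∧ (s \ N.pre a) ∩ N.post a = ∅, fun _ => (s \ N.pre a) ∪ N.post a⟩

theorem mem_step {a : E} {s t : Set P} :
    t ∈ (N.step a).app s ↔
      (N.pre a ⊆ s ∧ (s \ N.pre a) ∩ N.post a = ∅) ∧ t = (s \ N.pre a) ∪ N.post a :=
  ⟨fun ⟨h, e⟩ => ⟨h, e.symm⟩, fun ⟨h, e⟩ => ⟨h, e.symm⟩⟩

theorem mem_step_step {a b : E} (h : N.Indep a b) {s u : Set P}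
    (hu : u ∈ (N.step a * N.step b).app s) : u ∈ (N.step b * N.step a).app s := by
  rw [PartialEnd.mem_mul] at hu ⊢
  simp only [mem_step] at hu ⊢
  obtain ⟨t, ⟨⟨h1, h2⟩, rfl⟩, ⟨h3, h4⟩, rfl⟩ := hu
  simp only [Indep, Set.ext_iff, Set.subset_def, Set.mem_inter_iff, Set.mem_union, Set.mem_sdiff,
    Set.mem_empty_iff_false] at h h1 h2 h3 h4
  refine ⟨_, ⟨⟨?_, ?_⟩, rfl⟩, ⟨?_, ?_⟩, ?_⟩
  · intro x hx
    have := h x; have := h3 x hx; tauto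
  · ext x
    simp only [Set.mem_inter_iff, Set.mem_sdiff, Set.mem_empty_iff_false]
    have := h x; have := h4 x; tauto
  · intro x hx
    simp only [Set.mem_union, Set.mem_sdiff]
    have := h x; have := h1 x hx; tauto
  · ext x
    simp only [Set.mem_inter_iff, Set.mem_union, Set.mem_sdiff, Set.mem_empty_iff_false]
    have := h x; have := h2 x; tauto
  · ext x
    simp only [Set.mem_union, Set.mem_sdiff]
    have := h x; tauto

theorem step_comm {a b : E} (h : N.Indep a b) : N.step a * N.step b = N.step b * N.step a :=
  PartialEnd.ext fun _ _ =>
    ⟨N.mem_step_step h, N.mem_step_step (by rw [Indep, Set.inter_comm]; exact h)⟩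

/-- The state space `({0,1}^P, M(E, I))` of an elementary Petri net. -/
def stateSpace : StateSpace where
  State := Set P
  Event := E
  indep := N.Indep
  act := PresentedMonoid.lift N.step (by
    rintro _ _ ⟨a, b, h⟩
    simpa using N.step_comm h)

/-- The space of reachable states of an elementary Petri net. -/
def reachableStateSpace : StateSpace := N.stateSpace.reachableSpace N.init

/-- The directed homology groups `H_k^ε(N)` of an elementary Petri net. -/
noncomputable def directedHomology (ε : Fin 2) (k : ℕ) : AddCommGrpCat.{0} :=
  N.stateSpace.directedHomology ε k

end ElementaryPetriNet

/-- The pipeline Petri net `t₁ → p₁ → t₂ → p₂ → ⋯ → pₙ₋₁ → tₙ` with initial state `s₀`. The event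
`tᵢ` is `i - 1 : Fin n` and the place `pᵢ` is `i - 1 : Fin (n - 1)`, so the places before and after
the event `t` are those with `p + 1 = t` and `p = t` (as numbers), as far as they exist. -/
def pipeline (n : ℕ) (s₀ : Set (Fin (n - 1))) : ElementaryPetriNet (Fin (n - 1)) (Fin n) where
  pre t := {p | p.val + 1 = t.val}
  post t := {p | p.val = t.val}
  init := s₀

/-!
The directed homology of a state space is the homology of its state category `K(S)` with
coefficients in a functor that kills all nonidentity morphisms. For any small category `J`, any
functor `Φ : J ⥤ J` and any natural transformation `η : 𝟭 J ⟶ Φ`, the maps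
`colim F ⟶ colim (Φ ⋙ F) ⟶ colim F` induced by `η` and `Φ` compose to the identity. On a projective
resolution of a functor `F` with `F η = 0` the first map is null-homotopic, as it lifts zero to an
exact complex, so the homology of `J` with coefficients in `F` vanishes
(`isZero_colimDerived_of_natTrans`). It is thus enough to find a natural transformation
`𝟭 ⟶ Φ` on `K(S)`, and one on its opposite, all of whose components are given by nontrivial traces.

For the pipeline, fire at each state the event `a` that fills the first empty place (the last event,
if there is none). It is always enabled; any other enabled event `b` is independent of `a`, and
after `b` the first empty place is still the same (`Pipeline.persistentEvent`). So `a` and `b` span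
a commuting square. These squares compose to squares for arbitrary traces
(`StateSpace.PersistentEvent.exists_lift`), and a letter can be cancelled from the left in a trace
monoid, because deleting the first occurrence of an event is well defined on traces
(`TraceMonoid.of_mul_left_cancel`). The fourth side of a square is therefore unique, which makes it
functorial and the choice natural.

For the opposite category, complementing states reverses every step
(`ElementaryPetriNet.mem_step_compl`), which turns the choice above into a choice of incoming
events. Every state of the pipeline is reachable from every other (`Pipeline.reaches`), so both choices
restrict to the space of reachable states.
-/

/-! ### Vanishing criteria for derived functors and homology of categories -/

section Homology

variable {C : Type*} [Category* C] [Abelian C]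

/-- The components of a natural transformation `𝟭 C ⟶ G`, as a chain map `K ⟶ G K`. -/
def CategoryTheory.NatTrans.toMapComplex {G : C ⥤ C} [G.Additive] (η : 𝟭 C ⟶ G)
    (K : ChainComplex C ℕ) : K ⟶ (G.mapHomologicalComplex _).obj K where
  f i := η.app (K.X i)
  comm' i j _ := (η.naturality (K.d i j)).symm

/-- If `G` is exact and `η : 𝟭 C ⟶ G` vanishes at `X`, then `η` is null-homotopic on a projective
resolution `P` of `X`: it lifts `η.app X = 0` to the exact complex `G P`. -/
theorem CategoryTheory.ProjectiveResolution.nonempty_homotopy_toMapComplex_zero {G : C ⥤ C}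
    [G.Additive] [G.PreservesHomology] (η : 𝟭 C ⟶ G) {X : C} (P : ProjectiveResolution X)
    (h : η.app X = 0) : Nonempty (Homotopy (η.toMapComplex P.complex) 0) := by
  let c (i : ℕ) : P.complex.X i ⟶ G.obj (P.complex.X i) := η.app _
  have nat (i j : ℕ) : P.complex.d i j ≫ c j = c i ≫ G.map (P.complex.d i j) :=
    η.naturality (P.complex.d i j)
  have lift {A : C} [Projective A] (n : ℕ) (f : A ⟶ G.obj (P.complex.X (n + 1)))
      (hf : f ≫ G.map (P.complex.d (n + 1) n) = 0) :
      ∃ g : A ⟶ G.obj (P.complex.X (n + 2)), g ≫ G.map (P.complex.d (n + 2) (n + 1)) = f :=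
    ⟨_, ((P.exact_succ n).map G).liftFromProjective_comp f hf⟩
  obtain ⟨z, hz⟩ : ∃ z : P.complex.X 0 ⟶ G.obj (P.complex.X 1),
      z ≫ G.map (P.complex.d 1 0) = c 0 :=
    ⟨_, (P.exact₀.map G).liftFromProjective_comp (c 0) ((η.naturality (P.π.f 0)).symm.trans
      ((congrArg (P.π.f 0 ≫ ·) h).trans comp_zero))⟩
  obtain ⟨o, ho⟩ := lift 0 (c 1 - P.complex.d 1 0 ≫ z) (by
    rw [Preadditive.sub_comp, Category.assoc, hz, nat, sub_self])
  have succ (n : ℕ) (g : P.complex.X n ⟶ G.obj (P.complex.X (n + 1)))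
      (g' : P.complex.X (n + 1) ⟶ G.obj (P.complex.X (n + 2)))
      (w : c (n + 1) = P.complex.d (n + 1) n ≫ g + g' ≫ G.map (P.complex.d (n + 2) (n + 1))) :
      ∃ g'' : P.complex.X (n + 2) ⟶ G.obj (P.complex.X (n + 3)),
        c (n + 2) = P.complex.d (n + 2) (n + 1) ≫ g' +
          g'' ≫ G.map (P.complex.d (n + 3) (n + 2)) := by
    obtain ⟨g'', hg''⟩ := lift (n + 1) (c (n + 2) - P.complex.d (n + 2) (n + 1) ≫ g') (by
      rw [Preadditive.sub_comp, ← nat, w, Preadditive.comp_add, Category.assoc,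
        HomologicalComplex.d_comp_d_assoc, zero_comp, zero_add, sub_self])
    exact ⟨g'', by rw [hg'', add_sub_cancel]⟩
  choose s hs using succ
  exact ⟨Homotopy.mkInductive _ z hz.symm o
    ((add_sub_cancel _ _).symm.trans (congrArg (P.complex.d 1 0 ≫ z + ·) ho.symm))
    fun n ⟨g, g', w⟩ => ⟨s n g g' w, hs n g g' w⟩⟩

/-- The left derived functors of `T` vanish at `X` as soon as the identity of `T` factors through
`T η` for a natural transformation `η : 𝟭 C ⟶ G` to an exact functor with `η.app X = 0`. -/
theorem CategoryTheory.Functor.isZero_leftDerived_obj_of_retraction {D : Type*} [Category* D]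
    [Abelian D] [HasProjectiveResolutions C] (T : C ⥤ D) [T.Additive] {G : C ⥤ C} [G.Additive]
    [G.PreservesHomology] (η : 𝟭 C ⟶ G) (r : G ⋙ T ⟶ T)
    (hr : ∀ Y, T.map (η.app Y) ≫ r.app Y = 𝟙 (T.obj Y)) {X : C} (h : η.app X = 0) (k : ℕ) :
    IsZero ((T.leftDerived k).obj X) := by
  let P := projectiveResolution X
  refine IsZero.of_iso ?_ (P.isoLeftDerivedObj T k)
  let K := (T.mapHomologicalComplex (ComplexShape.down ℕ)).obj P.complex
  let p := (T.mapHomologicalComplex (ComplexShape.down ℕ)).map (η.toMapComplex P.complex)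
  let q : (T.mapHomologicalComplex (ComplexShape.down ℕ)).obj
      ((G.mapHomologicalComplex _).obj P.complex) ⟶ K :=
    { f := fun i => r.app (P.complex.X i)
      comm' := fun i j _ => (r.naturality (P.complex.d i j)).symm }
  have hpq : p ≫ q = 𝟙 K := by
    ext i : 1
    exact hr (P.complex.X i)
  have hp : HomologicalComplex.homologyMap p k = 0 := by
    have H := T.mapHomotopy (P.nonempty_homotopy_toMapComplex_zero η h).some
    rw [H.homologyMap_eq k, Functor.map_zero, HomologicalComplex.homologyMap_zero]
  change IsZero (K.homology k)
  rw [IsZero.iff_id_eq_zero, ← HomologicalComplex.homologyMap_id, ← hpq,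
    HomologicalComplex.homologyMap_comp, hp, zero_comp]

end Homology

section Colim

variable {J : Type} [SmallCategory J]

/-- If a functor `F` on `J` kills all components of a natural transformation `η : 𝟭 J ⟶ Φ`, then
the homology of `J` with coefficients in `F` vanishes, because the composite
`colim F ⟶ colim (Φ ⋙ F) ⟶ colim F` of the maps induced by `η` and `Φ` is the identity. -/
theorem isZero_colimDerived_of_natTrans (F : J ⥤ AddCommGrpCat.{0}) {Φ : J ⥤ J} (η : 𝟭 J ⟶ Φ)
    (h : ∀ j, F.map (η.app j) = 0) (k : ℕ) : IsZero (colimDerived F k) := by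
  let G := (Functor.whiskeringLeft J J AddCommGrpCat.{0}).obj Φ
  have : G.Additive := ⟨rfl⟩
  let α : 𝟭 (J ⥤ AddCommGrpCat.{0}) ⟶ G :=
    { app := fun A => { app := fun j => A.map (η.app j)
                        naturality := fun i j f => by
                          change A.map f ≫ A.map _ = A.map _ ≫ A.map (Φ.map f)
                          rw [← A.map_comp, ← A.map_comp]
                          exact congrArg A.map (η.naturality f) }
      naturality := fun A B f => by
        ext j : 2
        exact (f.naturality (η.app j)).symm }
  let r : G ⋙ colim ⟶ (colim : (J ⥤ AddCommGrpCat.{0}) ⥤ _) :=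
    { app := fun A => colimit.pre A Φ
      naturality := fun A B f => (colimit.pre_map f Φ).symm }
  refine Functor.isZero_leftDerived_obj_of_retraction colim α r (fun A => ?_) ?_ k
  · refine colimit.hom_ext fun j => ?_
    change colimit.ι A j ≫ colimMap (α.app A) ≫ colimit.pre A Φ = colimit.ι A j ≫ 𝟙 _
    rw [ι_colimMap_assoc, Category.comp_id]
    change A.map (η.app j) ≫ colimit.ι (Φ ⋙ A) j ≫ colimit.pre A Φ = _
    rw [colimit.ι_pre]
    exact colimit.w A (η.app j)
  · ext j : 2
    exact h j

/-- A family of epimorphisms `σ j : j ⟶ φ j` such that each `f ≫ σ j` factors through `σ i` for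
`f : i ⟶ j` makes `φ` a functor and `σ` a natural transformation; if `F` kills it, then the homology
of `J` with coefficients in `F` vanishes. -/
theorem isZero_colimDerived_of_epi (F : J ⥤ AddCommGrpCat.{0}) {φ : J → J} (σ : ∀ j, j ⟶ φ j)
    [∀ j, Epi (σ j)] (hσ : ∀ {i j} (f : i ⟶ j), ∃ g, σ i ≫ g = f ≫ σ j)
    (h : ∀ j, F.map (σ j) = 0) (k : ℕ) : IsZero (colimDerived F k) := by
  choose g hg using @hσ
  let Φ : J ⥤ J :=
    { obj := φ
      map := g
      map_id := fun j => by rw [← cancel_epi (σ j), hg, Category.id_comp, Category.comp_id]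
      map_comp := fun f f' => by
        rw [← cancel_epi (σ _), hg, Category.assoc, ← hg f', ← Category.assoc,
          ← hg f, Category.assoc] }
  exact isZero_colimDerived_of_natTrans F (Φ := Φ)
    { app := σ, naturality := fun _ _ f => (hg f).symm } h k

end Colim

/-! ### Cancellation in trace monoids -/

namespace TraceMonoid

variable {E : Type} {I : E → E → Prop}

/-- The generator of the trace monoid given by an event. -/
abbrev of (I : E → E → Prop) (a : E) : TraceMonoid I := PresentedMonoid.of (TraceRel I) a

theorem of_ne_one (a : E) : of I a ≠ 1 := fun h =>
  Nat.one_ne_zero (congrArg (fun μ => Multiplicative.toAdd (length μ)) h)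

theorem of_mul_of_comm {a b : E} (h : I a b) : of I a * of I b = of I b * of I a :=
  PresentedMonoid.mk_eq_mk_of_rel (.comm a b h)

@[elab_as_elim]
theorem induction {p : TraceMonoid I → Prop} (μ : TraceMonoid I) (one : p 1)
    (of : ∀ a, p (of I a)) (mul : ∀ μ ν, p μ → p ν → p (μ * ν)) : p μ := by
  obtain ⟨w, rfl⟩ := PresentedMonoid.surjective_mk μ
  induction w with
  | one => exact one
  | of a => exact of a
  | mul x y hx hy => exact mul _ _ hx hy

open Classical in
/-- Deleting the first occurrence of an event is well defined on traces. In a product it is deleted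
from the first factor that contains it, so the induction also needs that occurrence is well
defined. -/
theorem mk_erase_eq (a : E) {u v : FreeMonoid E} (h : conGen (TraceRel I) u v) :
    (a ∈ u.toList ↔ a ∈ v.toList) ∧
      PresentedMonoid.mk (TraceRel I) (FreeMonoid.ofList (u.toList.erase a)) =
        PresentedMonoid.mk (TraceRel I) (FreeMonoid.ofList (v.toList.erase a)) := by
  induction (h : ConGen.Rel (TraceRel I) u v) with
  | of u v h =>
    obtain ⟨b, c, h⟩ := h
    have hbc := of_mul_of_comm h
    refine ⟨by simp [FreeMonoid.toList_mul, or_comm], ?_⟩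
    simp only [FreeMonoid.toList_mul, FreeMonoid.toList_of, List.singleton_append,
      List.erase_cons]
    by_cases hb : b = a <;> by_cases hc : c = a
    · simp [hb, hc]
    · simp [hb, hc]
    · simp [hb, hc]
    · simpa [hb, hc] using! hbc
  | refl u => exact ⟨Iff.rfl, rfl⟩
  | symm _ ih => exact ⟨ih.1.symm, ih.2.symm⟩
  | trans _ _ ih₁ ih₂ => exact ⟨ih₁.1.trans ih₂.1, ih₁.2.trans ih₂.2⟩
  | @mul w x y z h₁ h₂ ih₁ ih₂ =>
    have e₁ : PresentedMonoid.mk (TraceRel I) w = PresentedMonoid.mk _ x :=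
      PresentedMonoid.mk_eq_mk_iff.2 h₁
    have e₂ : PresentedMonoid.mk (TraceRel I) y = PresentedMonoid.mk _ z :=
      PresentedMonoid.mk_eq_mk_iff.2 h₂
    simp only [FreeMonoid.toList_mul, List.mem_append, List.erase_append]
    refine ⟨or_congr ih₁.1 ih₂.1, ?_⟩
    by_cases ha : a ∈ w.toList
    · rw [if_pos ha, if_pos (ih₁.1.1 ha), FreeMonoid.ofList_append, FreeMonoid.ofList_append,
        map_mul, map_mul, ih₁.2, FreeMonoid.ofList_toList, FreeMonoid.ofList_toList, e₂]
    · rw [if_neg ha, if_neg (mt ih₁.1.2 ha), FreeMonoid.ofList_append, FreeMonoid.ofList_append,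
        map_mul, map_mul, ih₂.2, FreeMonoid.ofList_toList, FreeMonoid.ofList_toList, e₁]

theorem of_mul_left_cancel (a : E) {μ ν : TraceMonoid I} (h : of I a * μ = of I a * ν) :
    μ = ν := by
  classical
  obtain ⟨u, rfl⟩ := PresentedMonoid.surjective_mk μ
  obtain ⟨v, rfl⟩ := PresentedMonoid.surjective_mk ν
  have h' : PresentedMonoid.mk (TraceRel I) (FreeMonoid.of a * u) =
    PresentedMonoid.mk _ (FreeMonoid.of a * v) := h
  simpa [FreeMonoid.toList_mul] using (mk_erase_eq a (PresentedMonoid.mk_eq_mk_iff.1 h')).2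

/-- Reversal of traces, as a homomorphism to the opposite monoid. -/
def reverse : TraceMonoid I →* (TraceMonoid I)ᵐᵒᵖ :=
  PresentedMonoid.lift (fun a => MulOpposite.op (of I a)) (by
    rintro _ _ ⟨a, b, h⟩
    exact congrArg MulOpposite.op (of_mul_of_comm h).symm)

theorem reverse_reverse (μ : TraceMonoid I) : (reverse (reverse μ).unop).unop = μ := by
  induction μ using TraceMonoid.induction with
  | one => simp
  | of a => rfl
  | mul μ ν hμ hν => simp only [map_mul, MulOpposite.unop_mul, hμ, hν]

theorem of_mul_right_cancel (a : E) {μ ν : TraceMonoid I} (h : μ * of I a = ν * of I a) :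
    μ = ν := by
  have h' := congrArg (fun κ => (reverse κ).unop) h
  simp only [map_mul, MulOpposite.unop_mul] at h'
  rw [← reverse_reverse μ, of_mul_left_cancel a h', reverse_reverse]

end TraceMonoid

/-! ### State spaces with a distinguished event at each state -/

namespace StateSpace

variable {X : StateSpace}

/-- A choice of an event enabled at each state, such that any other enabled event is independent of
it and does not change the choice. -/
structure PersistentEvent (X : StateSpace) where
  /-- The chosen event. -/
  event : X.State → X.Event
  /-- The state after the chosen event. -/
  next : X.State → X.State
  mem (s) : next s ∈ (X.act (TraceMonoid.of _ (event s))).app s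
  indep {s t b} : t ∈ (X.act (TraceMonoid.of _ b)).app s → b ≠ event s → X.indep b (event s)
  event_eq {s t b} : t ∈ (X.act (TraceMonoid.of _ b)).app s → b ≠ event s → event t = event s

/-- The notion dual to `PersistentEvent`: a choice of an event leading to each state, such that any
other event leading there is independent of it and does not change the choice. Events are moreover
required to act injectively, so that predecessors under a given event are unique. -/
structure CopersistentEvent (X : StateSpace) where
  /-- The chosen event. -/
  event : X.State → X.Event
  /-- The state before the chosen event. -/
  prev : X.State → X.State
  mem (s) : s ∈ (X.act (TraceMonoid.of _ (event s))).app (prev s)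
  indep {s t b} : t ∈ (X.act (TraceMonoid.of _ b)).app s → b ≠ event t → X.indep b (event t)
  event_eq {s t b} : t ∈ (X.act (TraceMonoid.of _ b)).app s → b ≠ event t → event s = event t
  injective {s s' t b} : t ∈ (X.act (TraceMonoid.of _ b)).app s →
    t ∈ (X.act (TraceMonoid.of _ b)).app s' → s = s'

theorem mem_act_mul {s u : X.State} {μ ν : TraceMonoid X.indep} :
    u ∈ (X.act (μ * ν)).app s ↔ ∃ t, t ∈ (X.act μ).app s ∧ u ∈ (X.act ν).app t := by
  rw [map_mul, PartialEnd.mem_mul]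

theorem mem_act_one {s t : X.State} : t ∈ (X.act 1).app s ↔ t = s := by
  rw [map_one, PartialEnd.mem_one]

theorem PersistentEvent.exists_lift (D : X.PersistentEvent) (μ : TraceMonoid X.indep) :
    ∀ {s t : X.State}, t ∈ (X.act μ).app s → ∃ ν, D.next t ∈ (X.act ν).app (D.next s) ∧
      TraceMonoid.of _ (D.event s) * ν = μ * TraceMonoid.of _ (D.event t) := by
  induction μ using TraceMonoid.induction with
  | one =>
    intro s t h
    obtain rfl := mem_act_one.1 h
    exact ⟨1, mem_act_one.2 rfl, by rw [one_mul, mul_one]⟩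
  | of b =>
    intro s t h
    by_cases hb : b = D.event s
    · subst hb
      obtain rfl := Part.mem_unique h (D.mem s)
      exact ⟨_, D.mem _, rfl⟩
    -- The independent events `b` and `D.event s` span a commuting square.
    · have hbs := TraceMonoid.of_mul_of_comm (D.indep h hb)
      have ht := D.mem t
      rw [D.event_eq h hb] at ht ⊢
      have h₂ := mem_act_mul.2 ⟨t, h, ht⟩
      rw [hbs, mem_act_mul] at h₂
      obtain ⟨u, hu, hut⟩ := h₂
      obtain rfl := Part.mem_unique hu (D.mem s)
      exact ⟨_, hut, hbs.symm⟩
  | mul μ ν hμ hν =>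
    intro s u h
    obtain ⟨t, hst, htu⟩ := mem_act_mul.1 h
    obtain ⟨μ', h₁, e₁⟩ := hμ hst
    obtain ⟨ν', h₂, e₂⟩ := hν htu
    exact ⟨μ' * ν', mem_act_mul.2 ⟨_, h₁, h₂⟩, by rw [← mul_assoc, e₁, mul_assoc, e₂, mul_assoc]⟩

theorem CopersistentEvent.exists_lift (D : X.CopersistentEvent) (μ : TraceMonoid X.indep) :
    ∀ {s t : X.State}, t ∈ (X.act μ).app s → ∃ ν, D.prev t ∈ (X.act ν).app (D.prev s) ∧
      ν * TraceMonoid.of _ (D.event t) = TraceMonoid.of _ (D.event s) * μ := by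
  induction μ using TraceMonoid.induction with
  | one =>
    intro s t h
    obtain rfl := mem_act_one.1 h
    exact ⟨1, mem_act_one.2 rfl, by rw [one_mul, mul_one]⟩
  | of b =>
    intro s t h
    by_cases hb : b = D.event t
    · subst hb
      obtain rfl := D.injective h (D.mem t)
      exact ⟨_, D.mem _, rfl⟩
    -- The independent events `b` and `D.event t` span a commuting square.
    · have hbt := TraceMonoid.of_mul_of_comm (D.indep h hb)
      have hs := D.mem s
      rw [D.event_eq h hb] at hs ⊢
      have h₂ := mem_act_mul.2 ⟨s, hs, h⟩
      rw [← hbt, mem_act_mul] at h₂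
      obtain ⟨u, hu, hut⟩ := h₂
      obtain rfl := D.injective hut (D.mem t)
      exact ⟨_, hu, hbt⟩
  | mul μ ν hμ hν =>
    intro s u h
    obtain ⟨t, hst, htu⟩ := mem_act_mul.1 h
    obtain ⟨μ', h₁, e₁⟩ := hμ hst
    obtain ⟨ν', h₂, e₂⟩ := hν htu
    exact ⟨μ' * ν', mem_act_mul.2 ⟨_, h₁, h₂⟩, by rw [mul_assoc, e₂, ← mul_assoc, e₁, mul_assoc]⟩

theorem PersistentEvent.isZero_directedHomology (D : X.PersistentEvent) (k : ℕ) :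
    IsZero (X.directedHomology 0 k) := by
  let σ (s : X.StateCategory) : s ⟶ ⟨D.next s.state⟩ :=
    ⟨TraceMonoid.of _ (D.event s.state), D.mem s.state⟩
  have (s : X.StateCategory) : Epi (σ s) :=
    ⟨fun _ _ h => Subtype.ext (TraceMonoid.of_mul_left_cancel _ (congrArg trace h))⟩
  refine isZero_colimDerived_of_epi X.delta0 σ (fun f => ?_)
    (fun s => if_neg (TraceMonoid.of_ne_one _)) k
  obtain ⟨ν, hν, e⟩ := D.exists_lift (trace f) f.2
  exact ⟨⟨ν, hν⟩, Subtype.ext e⟩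

theorem CopersistentEvent.isZero_directedHomology (D : X.CopersistentEvent) (k : ℕ) :
    IsZero (X.directedHomology 1 k) := by
  let σ (s : X.StateCategoryᵒᵖ) : s ⟶ .op ⟨D.prev s.unop.state⟩ :=
    Quiver.Hom.op (V := X.StateCategory)
      ⟨TraceMonoid.of _ (D.event s.unop.state), D.mem s.unop.state⟩
  have (s : X.StateCategoryᵒᵖ) : Epi (σ s) :=
    ⟨fun _ _ h => Quiver.Hom.unop_inj <| Subtype.ext <|
      TraceMonoid.of_mul_right_cancel _ (congrArg Subtype.val (congrArg Quiver.Hom.unop h))⟩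
  refine isZero_colimDerived_of_epi X.delta1 σ (fun f => ?_)
    (fun s => if_neg (TraceMonoid.of_ne_one _)) k
  obtain ⟨ν, hν, e⟩ := D.exists_lift (trace f.unop) f.unop.2
  exact ⟨Quiver.Hom.op (V := X.StateCategory) ⟨ν, hν⟩, Quiver.Hom.unop_inj (Subtype.ext e)⟩

theorem mem_reachableSpace_act {s₀ : X.State} {s t : X.reachable s₀} {μ : TraceMonoid X.indep} :
    t ∈ ((X.reachableSpace s₀).act μ).app s ↔ t.1 ∈ (X.act μ).app s.1 :=
  PartialEnd.mem_restrict

theorem mem_reachable_of_mem_act {s₀ s t : X.State} {μ : TraceMonoid X.indep}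
    (hs : s ∈ X.reachable s₀) (h : t ∈ (X.act μ).app s) : t ∈ X.reachable s₀ :=
  let ⟨κ, hκ⟩ := hs
  ⟨κ * μ, mem_act_mul.2 ⟨s, hκ, h⟩⟩

/-- The restriction of a choice of enabled events to the reachable states. -/
def PersistentEvent.reachableSpace (D : X.PersistentEvent) (s₀ : X.State) :
    (X.reachableSpace s₀).PersistentEvent where
  event s := D.event s.1
  next s := ⟨D.next s.1, mem_reachable_of_mem_act s.2 (D.mem s.1)⟩
  mem s := mem_reachableSpace_act.2 (D.mem s.1)
  indep h := D.indep (mem_reachableSpace_act.1 h)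
  event_eq h := D.event_eq (mem_reachableSpace_act.1 h)

/-- The restriction of a choice of incoming events to the reachable states, if all the states
are reachable. -/
def CopersistentEvent.reachableSpace (D : X.CopersistentEvent) {s₀ : X.State}
    (hs₀ : ∀ s, s ∈ X.reachable s₀) : (X.reachableSpace s₀).CopersistentEvent where
  event s := D.event s.1
  prev s := ⟨D.prev s.1, hs₀ _⟩
  mem s := mem_reachableSpace_act.2 (D.mem s.1)
  indep h := D.indep (mem_reachableSpace_act.1 h)
  event_eq h := D.event_eq (mem_reachableSpace_act.1 h)
  injective h h' := Subtype.ext (D.injective (mem_reachableSpace_act.1 h)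
    (mem_reachableSpace_act.1 h'))

end StateSpace

/-! ### Complementation of states -/

theorem ElementaryPetriNet.mem_step_compl {P E : Type} (N : ElementaryPetriNet P E) {a : E}
    (ha : Disjoint (N.pre a) (N.post a)) {s t : Set P} (h : t ∈ (N.step a).app s) :
    sᶜ ∈ (N.step a).app tᶜ := by
  obtain ⟨⟨h₁, h₂⟩, rfl⟩ := N.mem_step.1 h
  rw [Set.disjoint_left] at ha
  simp only [mem_step, Set.ext_iff, Set.subset_def, Set.mem_inter_iff, Set.mem_union,
    Set.mem_sdiff, Set.mem_compl_iff, Set.mem_empty_iff_false] at *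
  exact ⟨⟨fun x hx => by have := @ha x hx; tauto,
    fun x => by tauto⟩, fun x => by have := @ha x; have := h₁ x; have := h₂ x; tauto⟩

/-- Complementation of states reverses the steps of a net without self-loops, so that it turns a
choice of enabled events into a choice of incoming events. -/
def StateSpace.PersistentEvent.compl {P E : Type} {N : ElementaryPetriNet P E}
    (hN : ∀ a, Disjoint (N.pre a) (N.post a)) (D : N.stateSpace.PersistentEvent) :
    N.stateSpace.CopersistentEvent :=
  let c : Set P → Set P := fun s => sᶜ
  have key {s t : Set P} {b : E} (h : t ∈ (N.step b).app s) : c s ∈ (N.step b).app (c t) :=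
    N.mem_step_compl (hN b) h
  { event := fun s => D.event (c s)
    prev := fun s => c (D.next (c s))
    mem := fun s => cast (congrArg (· ∈ (N.step (D.event (c s))).app (c (D.next (c s))))
      (compl_compl (α := Set P) s)) (key (D.mem (c s)))
    indep := fun h hb => D.indep (key h) hb
    event_eq := fun h hb => D.event_eq (key h) hb
    injective := fun h h' => compl_injective (α := Set P) (Part.mem_unique (key h) (key h')) }

/-! ### The pipeline -/

namespace Pipeline

variable {n : ℕ} {s₀ : Set (Fin (n - 1))}

/-- The event `t` puts a token on the first empty place of `s`; for the last event, which has no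
output place, this means that all places are filled. -/
def IsFirstHole (s : Set (Fin (n - 1))) (t : Fin n) : Prop :=
  (∀ p : Fin (n - 1), p.val = t.val → p ∉ s) ∧ ∀ p : Fin (n - 1), p.val < t.val → p ∈ s

theorem exists_isFirstHole (hn : 0 < n) (s : Set (Fin (n - 1))) : ∃ t, IsFirstHole s t := by
  classical
  have hex : ∃ m, ∀ p : Fin (n - 1), p.val = m → p ∉ s := ⟨n - 1, fun p hp => by omega⟩
  have hle : Nat.find hex ≤ n - 1 := Nat.find_min' hex fun p hp => by omega
  refine ⟨⟨Nat.find hex, by omega⟩, Nat.find_spec hex, fun p hp => ?_⟩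
  have := Nat.find_min hex hp
  push Not at this
  obtain ⟨q, hq, hqs⟩ := this
  rwa [Fin.ext hq] at hqs

theorem IsFirstHole.le {s : Set (Fin (n - 1))} {t u : Fin n} (ht : IsFirstHole s t)
    (hu : ∀ p : Fin (n - 1), p.val = u.val → p ∉ s) : t ≤ u := by
  by_contra! h
  exact hu ⟨u, by omega⟩ rfl (ht.2 _ h)

theorem IsFirstHole.unique {s : Set (Fin (n - 1))} {t u : Fin n} (ht : IsFirstHole s t)
    (hu : IsFirstHole s u) : t = u :=
  le_antisymm (ht.le hu.1) (hu.le ht.1)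

theorem mem_step_iff {s s' : Set (Fin (n - 1))} {t : Fin n} :
    s' ∈ ((pipeline n s₀).step t).app s ↔
      ((∀ p : Fin (n - 1), p.val + 1 = t.val → p ∈ s) ∧
        ∀ p : Fin (n - 1), p.val = t.val → p ∉ s) ∧
      ∀ p : Fin (n - 1), p ∈ s' ↔ p ∈ s ∧ p.val + 1 ≠ t.val ∨ p.val = t.val := by
  rw [ElementaryPetriNet.mem_step]
  simp only [pipeline, Set.ext_iff, Set.subset_def, Set.mem_inter_iff, Set.mem_union,
    Set.mem_sdiff, Set.mem_ofPred_eq, Set.mem_empty_iff_false, iff_false, not_and]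
  refine and_congr_left fun _ => and_congr_right fun _ => forall_congr' fun p => ?_
  constructor
  · exact fun h hp hs => h ⟨hs, by omega⟩ hp
  · exact fun h hs hp => h hp hs.1

theorem disjoint_pre_post (t : Fin n) :
    Disjoint ((pipeline n s₀).pre t) ((pipeline n s₀).post t) :=
  Set.disjoint_left.2 fun p (hp : p.val + 1 = t.val) (hp' : p.val = t.val) => by omega

/-- Any event enabled at `s` other than the one at the first hole lies at distance at least two
behind it. -/
theorem IsFirstHole.add_one_lt {s s' : Set (Fin (n - 1))} {t b : Fin n} (ht : IsFirstHole s t)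
    (h : s' ∈ ((pipeline n s₀).step b).app s) (hb : b ≠ t) : t.val + 1 < b.val := by
  obtain ⟨⟨h₁, h₂⟩, -⟩ := mem_step_iff.1 h
  have hle : t.val ≤ b.val := ht.le h₂
  have hne : t.val ≠ b.val := fun e => hb (Fin.ext e.symm)
  by_contra! hlt
  -- Otherwise the empty place after `t` is the input place of `b`.
  exact ht.1 ⟨t, by omega⟩ rfl (h₁ _ (show t.val + 1 = b.val by omega))

/-- An event far behind the first hole does not touch the places up to it. -/
theorem IsFirstHole.of_step {s s' : Set (Fin (n - 1))} {t b : Fin n} (ht : IsFirstHole s t)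
    (h : s' ∈ ((pipeline n s₀).step b).app s) (hb : b ≠ t) : IsFirstHole s' t := by
  have hlt := ht.add_one_lt h hb
  have h' := (mem_step_iff.1 h).2
  refine ⟨fun p hp hs' => ?_, fun p hp => (h' p).2 (.inl ⟨ht.2 p hp, by omega⟩)⟩
  rcases (h' p).1 hs' with hs | hs
  · exact ht.1 p hp hs.1
  · omega

theorem indep_of_add_one_lt {t b : Fin n} (h : t.val + 1 < b.val) :
    (pipeline n s₀).Indep b t := by
  simp only [ElementaryPetriNet.Indep, pipeline, Set.ext_iff, Set.mem_inter_iff, Set.mem_union,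
    Set.mem_ofPred_eq, Set.mem_empty_iff_false, iff_false]
  omega

theorem IsFirstHole.exists_mem_step {s : Set (Fin (n - 1))} {t : Fin n} (ht : IsFirstHole s t) :
    ∃ s', s' ∈ ((pipeline n s₀).step t).app s :=
  ⟨{p | p ∈ s ∧ p.val + 1 ≠ t.val ∨ p.val = t.val},
    mem_step_iff.2 ⟨⟨fun p hp => ht.2 p (by omega), ht.1⟩, fun _ => Iff.rfl⟩⟩

/-- The event at the first hole stays enabled, and stays at the first hole, until it occurs. -/
noncomputable def persistentEvent (hn : 0 < n) : (pipeline n s₀).stateSpace.PersistentEvent :=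
  have key (s : Set (Fin (n - 1))) := (exists_isFirstHole hn s).choose_spec
  { event := fun s => (exists_isFirstHole hn s).choose
    next := fun s => ((key s).exists_mem_step (s₀ := s₀)).choose
    mem := fun s => (key s).exists_mem_step.choose_spec
    indep := fun {s _ _} h hb => indep_of_add_one_lt ((key s).add_one_lt h hb)
    event_eq := fun {s t _} h hb => (key t).unique ((key s).of_step h hb) }

/-! ### Reachability in the pipeline -/

/-- The reachability relation of the pipeline. -/
def Reaches (s₀ s t : Set (Fin (n - 1))) : Prop := t ∈ (pipeline n s₀).stateSpace.reachable s

theorem Reaches.refl (s : Set (Fin (n - 1))) : Reaches s₀ s s :=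
  ⟨1, StateSpace.mem_act_one.2 rfl⟩

theorem Reaches.trans {s t u : Set (Fin (n - 1))} (h : Reaches s₀ s t) (h' : Reaches s₀ t u) :
    Reaches s₀ s u :=
  StateSpace.mem_reachable_of_mem_act h h'.choose_spec

theorem reaches_of_step {s t : Set (Fin (n - 1))} (b : Fin n)
    (h : t ∈ ((pipeline n s₀).step b).app s) : Reaches s₀ s t :=
  ⟨TraceMonoid.of _ b, h⟩

/-- A token can be put on any empty place: recursively fill the place before it, move that token
on, and fill the place before it again if it was filled at first. -/
theorem reaches_insert (m : ℕ) : ∀ (s : Set (Fin (n - 1))) (p : Fin (n - 1)), p.val = m →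
    Reaches s₀ s (insert p s) := by
  induction m with
  | zero =>
    intro s p hp
    by_cases hps : p ∈ s
    · rw [Set.insert_eq_of_mem hps]
      exact Reaches.refl s
    refine reaches_of_step ⟨p, by omega⟩ (mem_step_iff.2 ⟨⟨fun q hq => ?_, fun q hq => ?_⟩,
      fun q => ?_⟩)
    · simp only at hq; omega
    · rwa [Fin.ext hq]
    · rw [Set.mem_insert_iff, Fin.ext_iff, or_comm]
      exact or_congr_left (iff_self_and.2 fun _ => by simp only; omega)
  | succ m ih =>
    intro s p hp
    by_cases hps : p ∈ s
    · rw [Set.insert_eq_of_mem hps]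
      exact Reaches.refl s
    let q : Fin (n - 1) := ⟨m, by omega⟩
    have hqp : p ≠ q := fun e => by have := congrArg Fin.val e; simp only [q] at this; omega
    have h : Reaches s₀ (insert q s) (insert p (s \ {q})) := by
      refine reaches_of_step ⟨p, by omega⟩ (mem_step_iff.2 ⟨⟨fun r hr => ?_, fun r hr => ?_⟩,
        fun r => ?_⟩)
      · exact .inl (Fin.ext (Nat.succ.inj (hr.trans hp)))
      · rw [Fin.ext hr]
        exact fun h => h.elim hqp hps
      · have : r.val + 1 = p.val ↔ r = q := by rw [Fin.ext_iff, hp]; simp only [q]; omega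
        simp only [Set.mem_insert_iff, Set.mem_sdiff, Set.mem_singleton_iff, Fin.ext_iff] at this ⊢
        tauto
    have h' := Reaches.trans (ih s q rfl) h
    by_cases hqs : q ∈ s
    · have := Reaches.trans h' (ih _ q rfl)
      rwa [Set.insert_comm, Set.insert_sdiff_singleton, Set.insert_eq_of_mem hqs] at this
    · rwa [Set.sdiff_singleton_eq_self hqs] at h'

/-- The token on any place can be removed: recursively empty the place after it, move the token
on, and empty the place after it again if it was empty at first. -/
theorem reaches_diff_singleton (m : ℕ) : ∀ (s : Set (Fin (n - 1))) (p : Fin (n - 1)),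
    p.val + 1 + m = n - 1 → Reaches s₀ s (s \ {p}) := by
  induction m with
  | zero =>
    intro s p hp
    by_cases hps : p ∈ s
    swap
    · rw [Set.sdiff_singleton_eq_self hps]
      exact Reaches.refl s
    refine reaches_of_step ⟨p + 1, by omega⟩ (mem_step_iff.2 ⟨⟨fun q hq => ?_, fun q hq => ?_⟩,
      fun q => ?_⟩)
    · rwa [Fin.ext (Nat.succ.inj hq)]
    · simp only at hq; omega
    · rw [Set.mem_sdiff, Set.mem_singleton_iff, Fin.ext_iff]
      simp only
      constructor
      · exact fun h => .inl ⟨h.1, by omega⟩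
      · rintro (h | h)
        · exact ⟨h.1, by omega⟩
        · omega
  | succ m ih =>
    intro s p hp
    by_cases hps : p ∈ s
    swap
    · rw [Set.sdiff_singleton_eq_self hps]
      exact Reaches.refl s
    let q : Fin (n - 1) := ⟨p + 1, by omega⟩
    have hqp : p ≠ q := fun e => by have := congrArg Fin.val e; simp only [q] at this; omega
    have h : Reaches s₀ (s \ {q}) (insert q (s \ {p})) := by
      refine reaches_of_step ⟨q, by omega⟩ (mem_step_iff.2 ⟨⟨fun r hr => ?_, fun r hr => ?_⟩,
        fun r => ?_⟩)
      · rw [show r = p from Fin.ext (Nat.succ.inj hr)]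
        exact ⟨hps, hqp⟩
      · rw [show r = q from Fin.ext hr]
        exact fun h => h.2 rfl
      · have : r.val + 1 = q.val ↔ r = p := by rw [Fin.ext_iff]; simp only [q]; omega
        simp only [Set.mem_insert_iff, Set.mem_sdiff, Set.mem_singleton_iff, Fin.ext_iff] at this ⊢
        tauto
    have h' := Reaches.trans (ih s q (by simp only [q]; omega)) h
    by_cases hqs : q ∈ s
    · rwa [Set.insert_eq_of_mem (Set.mem_sdiff_singleton.2 ⟨hqs, hqp.symm⟩)] at h'
    · have := Reaches.trans h' (ih _ q (by simp only [q]; omega))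
      rwa [Set.insert_sdiff_self_of_notMem fun h => hqs h.1] at this

theorem reaches (s t : Set (Fin (n - 1))) : Reaches s₀ s t := by
  have h₁ : ∀ u : Set (Fin (n - 1)), Reaches s₀ u ∅ := fun u => by
    induction u, u.toFinite using Set.Finite.induction_on with
    | empty => exact Reaches.refl _
    | @insert p u hp _ ih =>
      have := reaches_diff_singleton (s₀ := s₀) (n - 1 - (p.val + 1)) (insert p u) p (by omega)
      rw [Set.insert_sdiff_self_of_notMem hp] at this
      exact Reaches.trans this ih
  have h₂ : ∀ u : Set (Fin (n - 1)), Reaches s₀ ∅ u := fun u => by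
    induction u, u.toFinite using Set.Finite.induction_on with
    | empty => exact Reaches.refl _
    | @insert p u _ _ ih => exact Reaches.trans ih (reaches_insert p.val u p rfl)
  exact (h₁ s).trans (h₂ t)

end Pipeline

/-- For `n ≥ 2` all directed homology groups of the pipeline net vanish, both for the space of all
states and for the space of states reachable from an arbitrary initial state. -/
theorem mainTheorem2 (n : ℕ) (hn : 2 ≤ n) (s₀ : Set (Fin (n - 1))) (ε : Fin 2) (k : ℕ) :
    IsZero ((pipeline n s₀).directedHomology ε k) ∧
      IsZero ((pipeline n s₀).reachableStateSpace.directedHomology ε k) := by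
  let D : (pipeline n s₀).stateSpace.PersistentEvent := Pipeline.persistentEvent (by omega)
  let D' : (pipeline n s₀).stateSpace.CopersistentEvent := D.compl Pipeline.disjoint_pre_post
  match ε with
  | 0 => exact ⟨D.isZero_directedHomology k, (D.reachableSpace s₀).isZero_directedHomology k⟩
  | 1 => exact ⟨D'.isZero_directedHomology k,
      (D'.reachableSpace (Pipeline.reaches s₀)).isZero_directedHomology k⟩
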